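/- **Extended Rashevsky–Chow Theorem for symmetric spaces.** A *symmetric space* is a smooth ($C^\infty$, finite-dimensional, Hausdorff) manifold $S$ that admits a smooth product $S\times S\to S$, $(a,b)\mapsto a\cdot b$, such that for all $a,b,c\in S$: (i) $a\cdot a=a$; (ii) $a\cdot(a\cdot b)=b$; (iii) $a\cdot(b\cdot c)=(a\cdot b)\cdot(a\cdot c)$; and (iv) every $a\in S$ has a neighbourhood $U$ such that $b\in U$ and $a\cdot b=b$ imply $b=a$. For smooth vector fields $X_1,\dots,X_m$ on $S$, let $LTS\{X_1,\dots,X_m\}$ be the smallest linear subspace of the space of smooth vector fields on $S$ that contains $X_1,\dots,X_m$ and is closed under the double Lie bracket $(A,B,C)\mapsto[[A,B],C]$. Let $S$ be a connected symmetric space of dimension $n$ and let $X_1,\dots,X_m$ be smooth vector fields on $S$ such that $$\{X(x) : X\in LTS\{X_1,\dots,X_m\}\}=T_xS\qquad\text{for all } x\in S .$$ Then the driftless control system $$\dot x=\sum_{i=1}^m u_i\,X_i(x)$$ is globally controllable on $S$: for all $x_1,x_2\in S$ and every $t_f>0$ there are a control $u\in L^2([0,t_f],\mathbb R^m)$ and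 a solution $x:[0,t_f]\to S$ (that is, a curve, absolutely continuous in charts, with $\dot x(t)=\sum_i u_i(t)X_i(x(t))$ for almost every $t\in[0,t_f]$) such that $x(0)=x_1$ and $x(t_f)=x_2$. -/

import Mathlib

open Set MeasureTheory
open scoped Manifold ContDiff Topology

/-- A smooth symmetric product on a smooth `n`-manifold `S` (left multiplication by `a` is the
symmetry at `a`): a smooth binary operation satisfying the three algebraic laws and such that
every `a` is an isolated fixed point of its own symmetry. -/
structure IsSymmetricProduct (n : ℕ) {S : Type*} [TopologicalSpace S]
    [ChartedSpace (EuclideanSpace ℝ (Fin n)) S] (μ : S → S → S) : Prop where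
  smooth : ContMDiff ((𝓡 n).prod (𝓡 n)) (𝓡 n) ∞ (fun p : S × S => μ p.1 p.2)
  idem : ∀ a, μ a a = a
  involutive : ∀ a b, μ a (μ a b) = b
  distrib : ∀ a b c, μ a (μ b c) = μ (μ a b) (μ a c)
  isolated : ∀ a, ∃ U ∈ 𝓝 a, ∀ b ∈ U, μ a b = b → b = a

/-- A smooth manifold is a symmetric space if it carries a smooth symmetric product. -/
def IsSymmetricSpace (n : ℕ) (S : Type*) [TopologicalSpace S]
    [ChartedSpace (EuclideanSpace ℝ (Fin n)) S] : Prop :=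
  ∃ μ : S → S → S, IsSymmetricProduct n μ

/-- The real vector space of smooth vector fields on a smooth `n`-manifold `S`. -/
abbrev SmoothVectorField (n : ℕ) (S : Type*) [TopologicalSpace S]
    [ChartedSpace (EuclideanSpace ℝ (Fin n)) S] [IsManifold (𝓡 n) ∞ S] : Type _ :=
  ContMDiffSection (𝓡 n) (EuclideanSpace ℝ (Fin n)) ∞ (fun x : S => TangentSpace (𝓡 n) x)

namespace SmoothVectorField

variable {n : ℕ} {S : Type*} [TopologicalSpace S]
  [ChartedSpace (EuclideanSpace ℝ (Fin n)) S] [IsManifold (𝓡 n) ∞ S]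

/-- The Lie bracket of two smooth vector fields, as a smooth vector field. -/
noncomputable def lieBracket (A B : SmoothVectorField n S) : SmoothVectorField n S where
  toFun := VectorField.mlieBracket (𝓡 n) (fun x => A x) (fun x => B x)
  contMDiff_toFun := by
    intro x
    have h2 : IsManifold (𝓡 n) (minSmoothness ℝ 2) S := by
      rw [minSmoothness_of_isRCLikeNormedField]; infer_instance
    have h3 : IsManifold (𝓡 n) (minSmoothness ℝ 3) S := by
      rw [minSmoothness_of_isRCLikeNormedField]; infer_instance
    have h1 : IsManifold (𝓡 n) (((⊤ : ℕ∞) : ℕ∞ω) + 1) S :=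
      IsManifold.of_le (m := ((⊤ : ℕ∞) : ℕ∞ω) + 1) (n := ∞) (by simp)
    exact ContMDiffAt.mlieBracket_vectorField (m := ⊤) (n := ⊤) (A.contMDiff x) (B.contMDiff x)
      (by simp)

/-- The Lie triple system generated by a set `F` of smooth vector fields: the smallest linear
subspace of the smooth vector fields that contains `F` and is closed under the double bracket
`[[A, B], C]`. -/
noncomputable def lieTripleSpan (F : Set (SmoothVectorField n S)) :
    Submodule ℝ (SmoothVectorField n S) :=
  sInf {V | F ⊆ V ∧ ∀ A ∈ V, ∀ B ∈ V, ∀ C ∈ V, lieBracket (lieBracket A B) C ∈ V}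

end SmoothVectorField

section Control

variable {n m : ℕ} {S : Type*} [TopologicalSpace S]
  [ChartedSpace (EuclideanSpace ℝ (Fin n)) S]

/-- `γ` is locally absolutely continuous on `[0, T]`: it is continuous there, and every piece of it
that runs inside a coordinate chart is absolutely continuous in that chart. -/
def IsAbsContCurveOn (n : ℕ) {S : Type*} [TopologicalSpace S]
    [ChartedSpace (EuclideanSpace ℝ (Fin n)) S] (γ : ℝ → S) (T : ℝ) : Prop :=
  ContinuousOn γ (Icc 0 T) ∧
    ∀ (x : S) (a b : ℝ), 0 ≤ a → a ≤ b → b ≤ T →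
      MapsTo γ (Icc a b) (chartAt (EuclideanSpace ℝ (Fin n)) x).source →
        AbsolutelyContinuousOnInterval
          (fun t => chartAt (EuclideanSpace ℝ (Fin n)) x (γ t)) a b

/-- `γ` is a (Caratheodory) solution on `[0, T]` of the Cauchy problem
`γ' (t) = f (γ t) (u t)`, `γ 0 = x₀`. -/
structure IsTrajectory (f : (x : S) → EuclideanSpace ℝ (Fin m) → TangentSpace (𝓡 n) x)
    (u : ℝ → EuclideanSpace ℝ (Fin m)) (T : ℝ) (x₀ : S) (γ : ℝ → S) : Prop where
  absCont : IsAbsContCurveOn n γ T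
  initial : γ 0 = x₀
  hasDeriv : ∀ᵐ t ∂(volume.restrict (Icc 0 T)),
    HasMFDerivAt 𝓘(ℝ, ℝ) (𝓡 n) γ t ((1 : ℝ →L[ℝ] ℝ).smulRight (f (γ t) (u t)))

/-- The control system `x' = f (x, u)` is globally controllable: for all `x₁`, `x₂` and every final
time `T > 0`, some control in `L²([0, T], ℝᵐ)` steers `x₁` to `x₂` in time exactly `T`. -/
def IsGloballyControllable
    (f : (x : S) → EuclideanSpace ℝ (Fin m) → TangentSpace (𝓡 n) x) : Prop :=
  ∀ (x₁ x₂ : S) (T : ℝ), 0 < T →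
    ∃ u : ℝ → EuclideanSpace ℝ (Fin m), MemLp u 2 (volume.restrict (Icc 0 T)) ∧
      ∃ γ : ℝ → S, IsTrajectory f u T x₁ γ ∧ γ T = x₂

/-- The right-hand side `∑ uᵢ Xᵢ(x)` of the driftless control system defined by `X₁, …, Xₘ`. -/
noncomputable def driftless [IsManifold (𝓡 n) ∞ S] (X : Fin m → SmoothVectorField n S) (x : S)
    (u : EuclideanSpace ℝ (Fin m)) : TangentSpace (𝓡 n) x :=
  ∑ i, u i • X i x

end Control

/-! This is the orbit proof of the Rashevsky–Chow theorem. A driftless system is reversible, so "can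
be steered to" is an equivalence relation. If its classes are open, connectedness leaves a single
class (`isSteered_of_connected`), and rescaling time adapts a path to the prescribed final time.

Openness is local. In a chart the fields are multiplied by a bump function, which makes them
complete; their flow lines inside the chart are still trajectories up to reparametrization
(`isSteered_of_flow`). Let `D z` be the span of all push-forwards to `z` of these fields under `C¹`
diffeomorphisms preserving the classes. The small-time flows belong to this group, so `D` is
flow-invariant, and differentiating along a flow shows that bracketing with a generator sends
sections of `D` to sections of `D` (`IsC1Flow.lieBracket_mem`). The Jacobi identity extends this to
everything the generators produce by brackets (`inChart_mem_of_mem_lieTripleSpan`), so the rank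
condition forces `D` to be the whole space at the centre of the chart.

Conjugating flows by the group elements then gives a map from a Euclidean parameter space into one
class whose strict derivative is onto, so the class is a neighbourhood of its base point
(`setOf_rel_mem_nhds`). -/

/-! ### Global flows of vector fields and their derivative in space. -/

section Flow

open Filter Metric
open scoped NNReal

variable {E : Type*} [NormedAddCommGroup E] [NormedSpace ℝ E]

/-- A two-sided Grönwall inequality. -/
theorem norm_le_gronwallBound_abs {h h' : ℝ → E} {δ K ε T : ℝ}
    (hd : ∀ s, |s| ≤ T → HasDerivAt h (h' s) s) (h0 : ‖h 0‖ ≤ δ)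
    (hb : ∀ s, |s| ≤ T → ‖h' s‖ ≤ K * ‖h s‖ + ε) {t : ℝ} (ht : |t| ≤ T) :
    ‖h t‖ ≤ gronwallBound δ K ε |t| := by
  rcases le_total 0 t with h0t | h0t
  · have key := norm_le_gronwallBound_of_norm_deriv_right_le (f := h) (f' := h') (a := 0) (b := T)
      (δ := δ) (K := K) (ε := ε)
      (fun s hs => (hd s (by rw [abs_of_nonneg hs.1]; exact hs.2)).continuousAt.continuousWithinAt)
      (fun s hs => (hd s (by rw [abs_of_nonneg hs.1]; exact hs.2.le)).hasDerivWithinAt) h0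
      (fun s hs => hb s (by rw [abs_of_nonneg hs.1]; exact hs.2.le))
      t ⟨h0t, by rwa [abs_of_nonneg h0t] at ht⟩
    simpa [abs_of_nonneg h0t] using key
  · have hd' : ∀ s, |s| ≤ T → HasDerivAt (fun r => h (-r)) (-h' (-s)) s := by
      intro s hs
      have := (hd (-s) (by rwa [abs_neg])).scomp s (hasDerivAt_neg s)
      simpa [Function.comp_def] using this
    have key := norm_le_gronwallBound_of_norm_deriv_right_le (f := fun r => h (-r))
      (f' := fun s => -h' (-s)) (a := 0) (b := T) (δ := δ) (K := K) (ε := ε)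
      (fun s hs => (hd' s (by rw [abs_of_nonneg hs.1]; exact hs.2)).continuousAt.continuousWithinAt)
      (fun s hs => (hd' s (by rw [abs_of_nonneg hs.1]; exact hs.2.le)).hasDerivWithinAt)
      (by simpa using h0)
      (fun s hs => by
        have := hb (-s) (by rw [abs_neg, abs_of_nonneg hs.1]; exact hs.2.le)
        simpa using this)
      (-t) ⟨by linarith, by rwa [abs_of_nonpos h0t] at ht⟩
    simpa [abs_of_nonpos h0t] using key

/-- Two solutions of an autonomous Lipschitz differential equation separate at most
exponentially. -/
theorem dist_solution_le {f : E → E} {K : ℝ≥0} (hK : LipschitzWith K f) {γ η : ℝ → E}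
    (hγ : ∀ t, HasDerivAt γ (f (γ t)) t) (hη : ∀ t, HasDerivAt η (f (η t)) t) (t : ℝ) :
    ‖γ t - η t‖ ≤ ‖γ 0 - η 0‖ * Real.exp (K * |t|) := by
  have := norm_le_gronwallBound_abs (h := fun t => γ t - η t)
    (h' := fun t => f (γ t) - f (η t)) (δ := ‖γ 0 - η 0‖) (K := K) (ε := 0) (T := |t|)
    (fun s _ => (hγ s).sub (hη s)) le_rfl
    (fun s _ => by simpa using hK.norm_sub_le (γ s) (η s)) le_rfl
  rwa [gronwallBound_ε0] at this

theorem solution_unique {f : E → E} {K : ℝ≥0} (hK : LipschitzWith K f) {γ η : ℝ → E}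
    (hγ : ∀ t, HasDerivAt γ (f (γ t)) t) (hη : ∀ t, HasDerivAt η (f (η t)) t) {t₀ : ℝ}
    (h0 : γ t₀ = η t₀) : γ = η :=
  ODE_solution_unique_univ (v := fun _ => f) (s := fun _ => univ) (fun _ => hK.lipschitzOnWith)
    (fun t => ⟨hγ t, trivial⟩) (fun t => ⟨hη t, trivial⟩) h0

/-- A bounded Lipschitz vector field is complete. -/
theorem exists_global_solution [CompleteSpace E] {f : E → E} {K L : ℝ≥0}
    (hK : LipschitzWith K f) (hL : ∀ x, ‖f x‖ ≤ L) (x : E) :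
    ∃ γ : ℝ → E, γ 0 = x ∧ ∀ t, HasDerivAt γ (f (γ t)) t := by
  -- Speed at most `L` confines a solution on `[-(n+1), n+1]` to a ball of radius `L (n+1)`, so
  -- Picard–Lindelöf covers the whole interval; uniqueness then glues these solutions.
  have hpl (n : ℕ) : ∃ α : ℝ → E, α 0 = x ∧
      ∀ t ∈ Ioo (-((n : ℝ) + 1)) ((n : ℝ) + 1), HasDerivAt α (f (α t)) t := by
    have hn : (0 : ℝ) < (n : ℝ) + 1 := by positivity
    have h := IsPicardLindelof.of_time_independent (f := f) (tmin := -((n : ℝ) + 1))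
      (tmax := (n : ℝ) + 1) (t₀ := ⟨0, by constructor <;> linarith⟩) (x₀ := x)
      (a := L * ((n : ℝ≥0) + 1)) (r := 0) (L := L) (K := K)
      (fun y _ => hL y) hK.lipschitzOnWith (by simp)
    obtain ⟨α, h0, hα⟩ := h.exists_eq_forall_mem_Icc_hasDerivWithinAt (x := x) (by simp)
    exact ⟨α, h0, fun t ht =>
      (hα t (Ioo_subset_Icc_self ht)).hasDerivAt (Icc_mem_nhds ht.1 ht.2)⟩
  choose α h0 hα using hpl
  have huniq : ∀ {m n : ℕ}, m ≤ n → ∀ t, |t| < (m : ℝ) + 1 → α m t = α n t := by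
    intro m n hmn t ht
    have hmn' : (m : ℝ) ≤ n := by exact_mod_cast hmn
    have hm : (0 : ℝ) < (m : ℝ) + 1 := by positivity
    refine ODE_solution_unique_of_mem_Ioo (v := fun _ => f) (s := fun _ => univ) (K := K)
      (a := -((m : ℝ) + 1)) (b := (m : ℝ) + 1) (t₀ := 0)
      (fun _ _ => hK.lipschitzOnWith) ⟨by linarith, hm⟩ (fun s hs => ⟨hα m s hs, trivial⟩)
      (fun s hs => ⟨hα n s ⟨by linarith [hs.1], by linarith [hs.2]⟩, trivial⟩)
      ((h0 m).trans (h0 n).symm) (abs_lt.1 ht)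
  have hγ : ∀ (n : ℕ) (t : ℝ), |t| < (n : ℝ) + 1 → α ⌈|t|⌉₊ t = α n t := by
    intro n t ht
    rcases le_total ⌈|t|⌉₊ n with h | h
    · exact huniq h t (by linarith [Nat.le_ceil |t|])
    · exact (huniq h t ht).symm
  refine ⟨fun t => α ⌈|t|⌉₊ t, by simpa using h0 0, fun t => ?_⟩
  have ht : |t| < (⌈|t|⌉₊ : ℝ) + 1 := by linarith [Nat.le_ceil |t|]
  refine (hα _ t (abs_lt.1 ht)).congr_of_eventuallyEq ?_
  filter_upwards [(isOpen_Iio.preimage continuous_abs).mem_nhds ht] with s hs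
  exact hγ _ s hs

/-- The flow of a complete vector field, continuous in all its variables. -/
structure IsGlobalFlow (f : E → E) (φ : ℝ → E → E) : Prop where
  zero : ∀ x, φ 0 x = x
  hasDerivAt : ∀ x t, HasDerivAt (fun s => φ s x) (f (φ t x)) t
  continuous : Continuous (fun p : ℝ × E => φ p.1 p.2)

/-- Joint continuity comes from Grönwall in the space variable and from a Lipschitz constant in time
that does not depend on the starting point. -/
theorem exists_isGlobalFlow [CompleteSpace E] {f : E → E} {K L : ℝ≥0}
    (hK : LipschitzWith K f) (hL : ∀ x, ‖f x‖ ≤ L) : ∃ φ, IsGlobalFlow f φ := by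
  choose γ h0 hγ using exists_global_solution hK hL
  refine ⟨fun t x => γ x t, h0, hγ, ?_⟩
  refine continuous_prod_of_continuous_lipschitzWith _ L (fun t => ?_) (fun x => ?_)
  · have : LipschitzWith (Real.toNNReal (Real.exp (K * |t|))) (fun x => γ x t) := by
      refine LipschitzWith.of_dist_le_mul fun x y => ?_
      have := dist_solution_le hK (hγ x) (hγ y) t
      rw [h0, h0] at this
      rw [dist_eq_norm, dist_eq_norm, Real.coe_toNNReal _ (Real.exp_pos _).le, mul_comm]
      exact this
    exact this.continuous
  · refine lipschitzWith_of_nnnorm_deriv_le (fun t => (hγ x t).differentiableAt) fun t => ?_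
    rw [(hγ x t).deriv]
    exact hL _

namespace IsGlobalFlow

variable {f : E → E} {φ : ℝ → E → E} {K : ℝ≥0}

theorem eq_of_hasDerivAt (h : IsGlobalFlow f φ) (hK : LipschitzWith K f) {γ : ℝ → E}
    (hγ : ∀ t, HasDerivAt γ (f (γ t)) t) (t : ℝ) : γ t = φ t (γ 0) :=
  congrFun (solution_unique hK hγ (h.hasDerivAt (γ 0)) (t₀ := 0) (h.zero _).symm) t

theorem add (h : IsGlobalFlow f φ) (hK : LipschitzWith K f) (s t : ℝ) (x : E) :
    φ (s + t) x = φ s (φ t x) := by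
  have := h.eq_of_hasDerivAt hK (γ := fun r => φ (r + t) x)
    (fun r => (h.hasDerivAt x (r + t)).comp_add_const r t) s
  simpa using this

/-- A flow line is either constant or avoids the zeros of the field. -/
theorem eq_or_ne_zero (h : IsGlobalFlow f φ) (hK : LipschitzWith K f) (t : ℝ) (x : E) :
    φ t x = x ∨ f (φ t x) ≠ 0 := by
  by_cases h0 : f (φ t x) = 0
  · left
    have := solution_unique hK (h.hasDerivAt x) (η := fun _ => φ t x)
      (fun s => by rw [h0]; exact hasDerivAt_const s _) (t₀ := t) rfl
    have h1 := congrFun this 0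
    simp only [h.zero] at h1
    exact h1.symm
  · exact Or.inr h0

end IsGlobalFlow

/-- The flow of a vector field together with its derivative in space, for small times. -/
structure IsC1Flow (f : E → E) (φ : ℝ → E → E) (M : ℝ → E → E →L[ℝ] E) (ε : ℝ) : Prop extends
    IsGlobalFlow f φ where
  add : ∀ s t x, φ (s + t) x = φ s (φ t x)
  eq_or_ne_zero : ∀ t x, φ t x = x ∨ f (φ t x) ≠ 0
  pos : 0 < ε
  cocycle_zero : ∀ x, M 0 x = ContinuousLinearMap.id ℝ E
  cocycle_continuous : Continuous (fun p : ℝ × E => M p.1 p.2)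
  cocycle_hasDerivAt : ∀ x, HasDerivAt (fun t => M t x) (fderiv ℝ f x) 0
  hasFDerivAt : ∀ t, |t| < ε → ∀ x, HasFDerivAt (φ t) (M t x) x

/-- If `f` has a Lipschitz derivative, its first order Taylor remainder is quadratic. -/
theorem norm_sub_sub_fderiv_le {f : E → E} {C : ℝ≥0} (hf : Differentiable ℝ f)
    (hC : LipschitzWith C (fderiv ℝ f)) (a b : E) :
    ‖f b - f a - fderiv ℝ f a (b - a)‖ ≤ C * ‖b - a‖ ^ 2 := by
  have := (convex_closedBall a ‖b - a‖).norm_image_sub_le_of_norm_hasFDerivWithin_le' (𝕜 := ℝ)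
    (f := f) (f' := fderiv ℝ f) (φ := fderiv ℝ f a) (C := C * ‖b - a‖) (x := a) (y := b)
    (fun x _ => (hf x).hasFDerivAt.hasFDerivWithinAt)
    (fun x hx => (hC.norm_sub_le x a).trans
      (mul_le_mul_of_nonneg_left (mem_closedBall_iff_norm.1 hx) C.2))
    (mem_closedBall_self (norm_nonneg _)) (mem_closedBall_iff_norm.2 le_rfl)
  rwa [mul_assoc, ← sq] at this

/-- If the operators `A s` solve the variational equation along the flow line through `x`, then
`A t` is the derivative of the flow at `x`. -/
theorem IsGlobalFlow.hasFDerivAt_of_variational {f : E → E} {φ : ℝ → E → E}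
    (h : IsGlobalFlow f φ) {K C : ℝ≥0} (hf : Differentiable ℝ f) (hK : LipschitzWith K f)
    (hC : LipschitzWith C (fderiv ℝ f)) {x : E} {A : ℝ → E →L[ℝ] E} {T : ℝ}
    (hA0 : A 0 = ContinuousLinearMap.id ℝ E)
    (hA : ∀ s, |s| ≤ T → HasDerivAt A ((fderiv ℝ f (φ s x)).comp (A s)) s)
    {t : ℝ} (ht : |t| ≤ T) : HasFDerivAt (φ t) (A t) x := by
  set B : ℝ := Real.exp (K * T) with hB
  have hT : 0 ≤ T := (abs_nonneg t).trans ht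
  have hflow : ∀ y s, |s| ≤ T → ‖φ s y - φ s x‖ ≤ B * ‖y - x‖ := by
    intro y s hs
    have := dist_solution_le hK (h.hasDerivAt y) (h.hasDerivAt x) s
    simp only [h.zero] at this
    rw [mul_comm]
    refine this.trans (mul_le_mul_of_nonneg_left ?_ (norm_nonneg _))
    exact Real.exp_le_exp.2 (mul_le_mul_of_nonneg_left hs K.2)
  have key : ∀ y, ‖φ t y - φ t x - A t (y - x)‖ ≤
      gronwallBound 0 K (C * B ^ 2 * ‖y - x‖ ^ 2) |t| := by
    intro y
    refine norm_le_gronwallBound_abs (h := fun s => φ s y - φ s x - A s (y - x))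
      (h' := fun s => f (φ s y) - f (φ s x) - fderiv ℝ f (φ s x) (A s (y - x)))
      (T := T) (fun s hs => ?_) ?_ (fun s hs => ?_) ht
    · refine ((h.hasDerivAt y s).sub (h.hasDerivAt x s)).sub ?_
      simpa using (hA s hs).clm_apply (hasDerivAt_const s (y - x))
    · simp [h.zero, hA0]
    -- The error satisfies the linearized equation up to a Taylor remainder quadratic in `y - x`, so
    -- Grönwall keeps it quadratic.
    · have e : f (φ s y) - f (φ s x) - fderiv ℝ f (φ s x) (A s (y - x))
          = (f (φ s y) - f (φ s x) - fderiv ℝ f (φ s x) (φ s y - φ s x))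
            + fderiv ℝ f (φ s x) (φ s y - φ s x - A s (y - x)) := by
        simp only [map_sub]; abel
      rw [e, add_comm]
      refine (norm_add_le _ _).trans (add_le_add ?_ ?_)
      · exact ((fderiv ℝ f (φ s x)).le_opNorm _).trans
          (mul_le_mul_of_nonneg_right (norm_fderiv_le_of_lipschitz ℝ hK) (norm_nonneg _))
      · refine (norm_sub_sub_fderiv_le hf hC _ _).trans ?_
        have := pow_le_pow_left₀ (norm_nonneg _) (hflow y s hs) 2
        rw [mul_pow] at this
        rw [mul_assoc]
        exact mul_le_mul_of_nonneg_left this C.2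
  have hlin : ∀ e, gronwallBound 0 K e |t| = e * gronwallBound 0 K 1 |t| := by
    intro e
    simp only [gronwallBound]
    split_ifs
    · simp
    · simp; ring
  refine HasFDerivAt.of_isLittleO ?_
  have hO : (fun y => φ t y - φ t x - A t (y - x)) =O[𝓝 x] (fun y => ‖y - x‖ ^ 2) := by
    refine Asymptotics.IsBigO.of_bound (C * B ^ 2 * gronwallBound 0 K 1 |t|)
      (Eventually.of_forall fun y => ?_)
    refine (key y).trans (le_of_eq ?_)
    rw [hlin, Real.norm_of_nonneg (by positivity)]
    ring
  refine hO.trans_isLittleO ?_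
  have := Asymptotics.isLittleO_pow_sub_sub x (m := 2) (by norm_num)
  exact this

/-- A smooth compactly supported vector field has a flow that is continuously differentiable for
small times. -/
theorem exists_isC1Flow [FiniteDimensional ℝ E] {f : E → E} (hf : ContDiff ℝ ∞ f)
    (hc : HasCompactSupport f) : ∃ φ M ε, IsC1Flow f φ M ε := by
  have : CompleteSpace E := FiniteDimensional.complete ℝ E
  obtain ⟨K, hK⟩ := hf.lipschitzWith_of_hasCompactSupport hc (by simp)
  have hf' : ContDiff ℝ ∞ (fderiv ℝ f) := hf.fderiv_right (by simp)
  obtain ⟨C, hC⟩ := hf'.lipschitzWith_of_hasCompactSupport (hc.fderiv ℝ) (by simp)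
  -- The field is coupled to its variational equation `A' = Df(x) ∘ A`. That equation is unbounded
  -- in `A`, so it is cut off outside the ball of radius `2`, leaving room around the initial value
  -- `id`.
  let χ : ContDiffBump (0 : E →L[ℝ] E) := ⟨2, 3, by norm_num, by norm_num⟩
  let g : E × (E →L[ℝ] E) → E × (E →L[ℝ] E) := fun p => χ p.2 • (f p.1, (fderiv ℝ f p.1).comp p.2)
  have hg : ContDiff ℝ ∞ g := by
    refine (χ.contDiff.comp contDiff_snd).smul ((hf.comp contDiff_fst).prodMk ?_)
    exact (hf'.comp contDiff_fst).clm_comp contDiff_snd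
  have hgc : HasCompactSupport g := by
    refine HasCompactSupport.intro (K := tsupport f ×ˢ tsupport χ)
      (hc.prod χ.hasCompactSupport) ?_
    rintro ⟨x, A⟩ hp
    rw [mem_prod, not_and_or] at hp
    rcases hp with h | h
    · have h1 : f x = 0 := image_eq_zero_of_notMem_tsupport h
      have h2 : fderiv ℝ f x = 0 :=
        image_eq_zero_of_notMem_tsupport (fun h' => h (tsupport_fderiv_subset ℝ h'))
      simp [g, h1, h2]
    · have h1 : χ A = 0 := image_eq_zero_of_notMem_tsupport h
      simp [g, h1]
  obtain ⟨K', hK'⟩ := hg.lipschitzWith_of_hasCompactSupport hgc (by simp)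
  obtain ⟨L, hL⟩ := hc.exists_bound_of_continuous hf.continuous
  obtain ⟨L', hL'⟩ := hgc.exists_bound_of_continuous hg.continuous
  obtain ⟨φ, hφ⟩ := exists_isGlobalFlow (L := L.toNNReal) hK
    (fun x => (hL x).trans (Real.le_coe_toNNReal L))
  obtain ⟨ψ, hψ⟩ := exists_isGlobalFlow (L := L'.toNNReal) hK'
    (fun x => (hL' x).trans (Real.le_coe_toNNReal L'))
  set I : E →L[ℝ] E := ContinuousLinearMap.id ℝ E
  -- The coupled system has speed at most `L'`, so up to time `ε` the operator moves by at most `1`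
  -- and never meets the cutoff.
  set ε : ℝ := (L'.toNNReal + 1 : ℝ)⁻¹ with hε
  have hεpos : 0 < ε := by positivity
  have hball : ∀ t x, |t| ≤ ε → (ψ t (x, I)).2 ∈ closedBall (0 : E →L[ℝ] E) 2 := by
    intro t x ht
    have hlip : LipschitzWith L'.toNNReal (fun s => ψ s (x, I)) := by
      refine lipschitzWith_of_nnnorm_deriv_le (fun t => (hψ.hasDerivAt _ t).differentiableAt)
        fun t => ?_
      rw [(hψ.hasDerivAt _ t).deriv]
      exact (hL' _).trans (Real.le_coe_toNNReal L')
    have h1 := hlip.norm_sub_le t 0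
    have h2 : ‖(ψ t (x, I)).2 - I‖ ≤ 1 := by
      have h3 : ‖(ψ t (x, I)).2 - I‖ ≤ ‖ψ t (x, I) - ψ 0 (x, I)‖ := by
        rw [hψ.zero]; exact norm_snd_le (ψ t (x, I) - (x, I))
      refine h3.trans (h1.trans ?_)
      rw [sub_zero, Real.norm_eq_abs]
      calc (L'.toNNReal : ℝ) * |t| ≤ (L'.toNNReal + 1 : ℝ) * ε := by
            gcongr
            linarith
        _ = 1 := mul_inv_cancel₀ (by positivity)
    rw [mem_closedBall_zero_iff]
    calc ‖(ψ t (x, I)).2‖ = ‖((ψ t (x, I)).2 - I) + I‖ := by rw [sub_add_cancel]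
      _ ≤ 1 + 1 := (norm_add_le _ _).trans (add_le_add h2 ContinuousLinearMap.norm_id_le)
      _ = 2 := by norm_num
  have hg1 : ∀ t x, |t| ≤ ε → g (ψ t (x, I)) =
      (f (ψ t (x, I)).1, (fderiv ℝ f (ψ t (x, I)).1).comp (ψ t (x, I)).2) := by
    intro t x ht
    have : χ (ψ t (x, I)).2 = 1 := χ.one_of_mem_closedBall (hball t x ht)
    simp only [g, this, one_smul]
  have hψ1 : ∀ t x, |t| ≤ ε → (ψ t (x, I)).1 = φ t x := by
    intro t x ht
    have := norm_le_gronwallBound_abs (h := fun s => (ψ s (x, I)).1 - φ s x)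
      (h' := fun s => f (ψ s (x, I)).1 - f (φ s x)) (δ := 0) (K := K) (ε := 0) (T := ε)
      (fun s hs => ?_) (by simp [hψ.zero, hφ.zero])
      (fun s _ => by simpa using hK.norm_sub_le _ _) ht
    · rw [gronwallBound_ε0_δ0] at this
      exact sub_eq_zero.1 (norm_le_zero_iff.1 this)
    · refine HasDerivAt.sub ?_ (hφ.hasDerivAt x s)
      have h1 := (hψ.hasDerivAt (x, I) s)
      rw [hg1 s x hs] at h1
      exact h1.fst
  have hder : ∀ x s, |s| ≤ ε → HasDerivAt (fun t => (ψ t (x, I)).2)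
      ((fderiv ℝ f (φ s x)).comp (ψ s (x, I)).2) s := by
    intro x s hs
    have h1 := (hψ.hasDerivAt (x, I) s)
    rw [hg1 s x hs] at h1
    have h2 : HasDerivAt (fun t => (ψ t (x, I)).2)
        ((fderiv ℝ f (ψ s (x, I)).1).comp (ψ s (x, I)).2) s := h1.snd
    rwa [hψ1 s x hs] at h2
  refine ⟨φ, fun t x => (ψ t (x, I)).2, ε,
    { toIsGlobalFlow := hφ
      add := hφ.add hK
      eq_or_ne_zero := hφ.eq_or_ne_zero hK
      pos := hεpos
      cocycle_zero := fun x => by rw [hψ.zero]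
      cocycle_continuous := ?_
      cocycle_hasDerivAt := fun x => ?_
      hasFDerivAt := fun t ht x => ?_ }⟩
  · exact (hψ.continuous.comp
      (continuous_fst.prodMk (continuous_snd.prodMk continuous_const))).snd
  · have := hder x 0 (by simpa using hεpos.le)
    simpa [hψ.zero, hφ.zero, I] using this
  · exact hφ.hasFDerivAt_of_variational (hf.differentiable (by simp)) hK hC
      (A := fun t => (ψ t (x, I)).2) (by rw [hψ.zero]) (hder x) ht.le

end Flow

/-! ### The orbit distribution and the openness of orbits. -/

section Orbit

open Filter

variable {E : Type*} [NormedAddCommGroup E] [NormedSpace ℝ E]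

/-- The group of `C¹` diffeomorphisms that preserve every class of the equivalence relation `R`. -/
def c1Preserving (R : Setoid E) : Subgroup (Equiv.Perm E) where
  carrier := {P | ContDiff ℝ 1 P ∧ ContDiff ℝ 1 (P⁻¹ : Equiv.Perm E) ∧ ∀ z, R z (P z)}
  one_mem' := ⟨contDiff_id, contDiff_id, fun z => R.refl z⟩
  mul_mem' := by
    rintro P Q ⟨hP, hP', hPR⟩ ⟨hQ, hQ', hQR⟩
    refine ⟨hP.comp hQ, ?_, fun z => R.trans (hQR z) (hPR (Q z))⟩
    rw [mul_inv_rev]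
    exact hQ'.comp hP'
  inv_mem' := by
    rintro P ⟨hP, hP', hPR⟩
    refine ⟨hP', by rwa [inv_inv], fun z => R.symm ?_⟩
    simpa using hPR (P⁻¹ z)

variable {ι : Type*} {Y : ι → E → E} {R : Setoid E}

/-- The span at `z` of all images of the fields `Y i` under the diffeomorphisms in
`c1Preserving R`. -/
def orbitDistribution (R : Setoid E) (Y : ι → E → E) (z : E) : Submodule ℝ E :=
  Submodule.span ℝ {v | ∃ P ∈ c1Preserving R, ∃ p i, P p = z ∧ v = fderiv ℝ P p (Y i p)}

theorem mem_orbitDistribution (i : ι) (z : E) : Y i z ∈ orbitDistribution R Y z :=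
  Submodule.subset_span ⟨1, one_mem _, z, i, rfl, by
    have : ((1 : Equiv.Perm E) : E → E) = id := rfl
    simp [this]⟩

/-- By the chain rule, pushing forward by `P` and then by `Q` is pushing forward by `Q * P`, again a
member of the group. -/
theorem fderiv_mem_orbitDistribution {Q : Equiv.Perm E} (hQ : Q ∈ c1Preserving R) {z v : E}
    (hv : v ∈ orbitDistribution R Y z) : fderiv ℝ Q z v ∈ orbitDistribution R Y (Q z) := by
  induction hv using Submodule.span_induction with
  | mem v hv =>
    obtain ⟨P, hP, p, i, rfl, rfl⟩ := hv
    refine Submodule.subset_span ⟨Q * P, mul_mem hQ hP, p, i, rfl, ?_⟩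
    have := fderiv_comp p (hQ.1.differentiable one_ne_zero (P p))
      (hP.1.differentiable one_ne_zero p)
    rw [Equiv.Perm.coe_mul, this]
    rfl
  | zero => simp
  | add x y _ _ hx hy => rw [map_add]; exact add_mem hx hy
  | smul a x _ hx => rw [map_smul]; exact Submodule.smul_mem _ _ hx

/-- The flow at a fixed time, as a permutation. -/
def IsC1Flow.perm {f : E → E} {φ : ℝ → E → E} {M : ℝ → E → E →L[ℝ] E} {ε : ℝ}
    (h : IsC1Flow f φ M ε) (t : ℝ) : Equiv.Perm E where
  toFun := φ t
  invFun := φ (-t)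
  left_inv x := by rw [← h.add, neg_add_cancel, h.zero]
  right_inv x := by rw [← h.add, add_neg_cancel, h.zero]

namespace IsC1Flow

variable {f : E → E} {φ : ℝ → E → E} {M : ℝ → E → E →L[ℝ] E} {ε : ℝ}

theorem contDiff (h : IsC1Flow f φ M ε) {t : ℝ} (ht : |t| < ε) : ContDiff ℝ 1 (φ t) :=
  contDiff_one_iff_hasFDerivAt.2 ⟨M t, h.cocycle_continuous.comp
    (continuous_const.prodMk continuous_id), h.hasFDerivAt t ht⟩

theorem perm_mem (h : IsC1Flow f φ M ε) (hR : ∀ t z, R z (φ t z)) {t : ℝ} (ht : |t| < ε) :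
    h.perm t ∈ c1Preserving R :=
  ⟨h.contDiff ht, h.contDiff (t := -t) (by rwa [abs_neg]), hR t⟩

/-- The flow is strictly differentiable in time and space at time `0`. -/
theorem hasStrictFDerivAt (h : IsC1Flow f φ M ε) (hf : Continuous f) (p : E) :
    HasStrictFDerivAt (fun q : ℝ × E => φ q.1 q.2)
      ((ContinuousLinearMap.toSpanSingleton ℝ (f p)).coprod (ContinuousLinearMap.id ℝ E))
      (0, p) := by
  have := hasStrictFDerivAt_uncurry_coprod (𝕜 := ℝ) (u := ((0 : ℝ), p)) (f := φ)
    (f₁ := fun t x => ContinuousLinearMap.toSpanSingleton ℝ (f (φ t x))) (f₂ := M)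
    (Eventually.of_forall fun v => (h.hasDerivAt v.2 v.1).hasFDerivAt) ?_ ?_
    h.cocycle_continuous.continuousAt
  · simpa [Function.HasUncurry.uncurry, h.zero, h.cocycle_zero] using this
  · have : ∀ᶠ v : ℝ × E in 𝓝 (0, p), |v.1| < ε :=
      (isOpen_Iio.preimage (continuous_abs.comp continuous_fst)).mem_nhds (by simpa using h.pos)
    filter_upwards [this] with v hv
    exact h.hasFDerivAt v.1 hv v.2
  · refine Continuous.continuousAt ?_
    exact (ContinuousLinearMap.toSpanSingletonCLE (𝕜 := ℝ) (E := E)).continuous.comp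
      (hf.comp h.continuous)

/-- The Lie bracket with `f` preserves sections of a closed family of subspaces that is invariant
under the flow of `f`. -/
theorem lieBracket_mem (h : IsC1Flow f φ M ε) {D : E → Submodule ℝ E}
    (hD : ∀ t, |t| < ε → ∀ z v, v ∈ D z → M t z v ∈ D (φ t z)) {z : E}
    (hclosed : IsClosed (D z : Set E)) {Z : E → E} (hZ : DifferentiableAt ℝ Z z)
    (hZD : ∀ᶠ y in 𝓝 z, Z y ∈ D y) : VectorField.lieBracket ℝ f Z z ∈ D z := by
  -- The derivative of `k` at `0` is the bracket. Transporting `t⁻¹ • k t` back to `z` keeps it in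
  -- the fixed closed subspace `D z` without changing its limit, so no regularity of `D` in `z` is
  -- needed.
  set k : ℝ → E := fun t => Z (φ t z) - M t z (Z z) with hk
  have hk0 : k 0 = 0 := by simp [hk, h.zero, h.cocycle_zero]
  have hφ0 : HasDerivAt (fun t => φ t z) (f z) 0 := by simpa [h.zero] using h.hasDerivAt z 0
  have hkd : HasDerivAt k (VectorField.lieBracket ℝ f Z z) 0 := by
    rw [VectorField.lieBracket]
    have hZ' : HasFDerivAt Z (fderiv ℝ Z z) (φ 0 z) := by rw [h.zero]; exact hZ.hasFDerivAt
    refine (hZ'.comp_hasDerivAt 0 hφ0).sub ?_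
    simpa using (h.cocycle_hasDerivAt z).clm_apply (hasDerivAt_const 0 (Z z))
  have hcont : Tendsto (fun t => φ t z) (𝓝 0) (𝓝 z) := by
    simpa [h.zero] using hφ0.continuousAt.tendsto
  have hsmall : ∀ᶠ t : ℝ in 𝓝 0, |t| < ε :=
    (isOpen_Iio.preimage continuous_abs).mem_nhds (by simpa using h.pos)
  have hM : Tendsto (fun t => M (-t) (φ t z)) (𝓝 0) (𝓝 (ContinuousLinearMap.id ℝ E)) := by
    have h1 : Tendsto (fun t : ℝ => (-t, φ t z)) (𝓝 0) (𝓝 (0, z)) := by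
      refine Tendsto.prodMk_nhds ?_ hcont
      simpa using (continuous_neg (G := ℝ)).tendsto 0
    have := (h.cocycle_continuous.tendsto (0, z)).comp h1
    simpa [h.cocycle_zero, Function.comp_def] using this
  have hlim : Tendsto (fun t => M (-t) (φ t z) (t⁻¹ • k t)) (𝓝[≠] 0)
      (𝓝 (VectorField.lieBracket ℝ f Z z)) := by
    have h1 := hkd.tendsto_slope_zero
    simp only [zero_add, hk0, sub_zero] at h1
    have h2 := (isBoundedBilinearMap_apply (𝕜 := ℝ) (E := E) (F := E)).continuous.tendsto
      (ContinuousLinearMap.id ℝ E, VectorField.lieBracket ℝ f Z z)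
    exact h2.comp ((hM.mono_left nhdsWithin_le_nhds).prodMk_nhds h1)
  refine hclosed.mem_of_tendsto hlim ?_
  filter_upwards [nhdsWithin_le_nhds hsmall, nhdsWithin_le_nhds (hcont.eventually hZD)]
    with t ht htZ
  have h1 : k t ∈ D (φ t z) := sub_mem htZ (hD t ht z _ hZD.self_of_nhds)
  have h2 := hD (-t) (by rwa [abs_neg]) (φ t z) _ (Submodule.smul_mem _ t⁻¹ h1)
  rwa [← h.add, neg_add_cancel, h.zero] at h2

end IsC1Flow

variable [FiniteDimensional ℝ E] {φ : ι → ℝ → E → E} {M : ι → ℝ → E → E →L[ℝ] E} {ε : ι → ℝ}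

theorem lieBracket_mem_orbitDistribution (h : ∀ i, IsC1Flow (Y i) (φ i) (M i) (ε i))
    (hR : ∀ i t z, R z (φ i t z)) (i : ι) {z : E} {Z : E → E} (hZ : DifferentiableAt ℝ Z z)
    (hZD : ∀ᶠ y in 𝓝 z, Z y ∈ orbitDistribution R Y y) :
    VectorField.lieBracket ℝ (Y i) Z z ∈ orbitDistribution R Y z := by
  refine (h i).lieBracket_mem (fun t ht y v hv => ?_) (Submodule.closed_of_finiteDimensional _)
    hZ hZD
  have := fderiv_mem_orbitDistribution ((h i).perm_mem (hR i) ht) hv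
  rwa [show ((h i).perm t : E → E) = φ i t from rfl, ((h i).hasFDerivAt t ht y).fderiv] at this

/-- If the orbit distribution is the whole space at `x`, then the class of `x` is a neighbourhood
of `x`. -/
theorem setOf_rel_mem_nhds (h : ∀ i, IsC1Flow (Y i) (φ i) (M i) (ε i))
    (hY : ∀ i, Continuous (Y i)) (hR : ∀ i t z, R z (φ i t z)) {x : E}
    (hx : orbitDistribution R Y x = ⊤) : {y | R x y} ∈ 𝓝 x := by
  classical
  have : CompleteSpace E := FiniteDimensional.complete ℝ E
  obtain ⟨s, hs, hspan⟩ := Submodule.fg_span_iff_fg_span_finset_subset _ |>.1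
    (show (Submodule.span ℝ {v | ∃ P ∈ c1Preserving R, ∃ p i, P p = x ∧
      v = fderiv ℝ P p (Y i p)}).FG from IsNoetherian.noetherian _)
  have hs' : Submodule.span ℝ (s : Set E) = ⊤ := by rw [← hspan]; exact hx
  have key : ∀ t : Finset E, (t : Set E) ⊆ {v | ∃ P ∈ c1Preserving R, ∃ p i, P p = x ∧
      v = fderiv ℝ P p (Y i p)} → ∃ (k : ℕ) (F : (Fin k → ℝ) → E) (F' : (Fin k → ℝ) →L[ℝ] E),
      F 0 = x ∧ (∀ a, R x (F a)) ∧ HasStrictFDerivAt F F' 0 ∧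
      Submodule.span ℝ (t : Set E) ≤ F'.range := by
    intro t
    induction t using Finset.induction_on with
    | empty =>
      exact fun _ => ⟨0, fun _ => x, 0, rfl, fun _ => R.refl x, hasStrictFDerivAt_const x 0,
        by simp⟩
    | insert v t _ ih =>
      intro hsub
      obtain ⟨k, F, F', hF0, hFR, hF', hFt⟩ := ih (fun w hw => hsub (by simp [Finset.mem_coe.1 hw]))
      obtain ⟨P, hP, p, i, hPp, rfl⟩ := hsub (Finset.mem_coe.2 (Finset.mem_insert_self v t))
      have hPx : (P⁻¹ : Equiv.Perm E) x = p := by rw [← hPp]; simp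
      set Q : E → E := ⇑(P⁻¹ : Equiv.Perm E) with hQ
      have hPstrict : HasStrictFDerivAt P (fderiv ℝ P p) p :=
        (hP.1.contDiffAt (x := p)).hasStrictFDerivAt one_ne_zero
      have hQstrict : HasStrictFDerivAt Q (fderiv ℝ Q x) x :=
        (hP.2.1.contDiffAt (x := x)).hasStrictFDerivAt one_ne_zero
      have hPQ : (fderiv ℝ P p).comp (fderiv ℝ Q x) = ContinuousLinearMap.id ℝ E := by
        have h1 : HasFDerivAt (fun y => P (Q y)) ((fderiv ℝ P p).comp (fderiv ℝ Q x)) x :=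
          HasFDerivAt.comp x (by rw [hPx]; exact hPstrict.hasFDerivAt) hQstrict.hasFDerivAt
        have h2 : (fun y => P (Q y)) = id := by ext y; simp [hQ]
        rw [h2] at h1
        exact h1.unique (hasFDerivAt_id x)
      let l : (Fin (k + 1) → ℝ) →L[ℝ] ℝ := ContinuousLinearMap.proj 0
      let r : (Fin (k + 1) → ℝ) →L[ℝ] (Fin k → ℝ) :=
        ContinuousLinearMap.pi fun j => ContinuousLinearMap.proj j.succ
      -- The flow of `Y i` conjugated by `P` is applied after `F`. At `0`, the new parameter
      -- contributes `dP (Y i p)`, while the old ones contribute `dP ∘ dQ ∘ F' = F'`.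
      refine ⟨k + 1, fun a => P (φ i (l a) (Q (F (r a)))),
        (fderiv ℝ P p).comp (((ContinuousLinearMap.toSpanSingleton ℝ (Y i p)).coprod
          (ContinuousLinearMap.id ℝ E)).comp (l.prod ((fderiv ℝ Q x).comp (F'.comp r)))),
        ?_, fun a => ?_, ?_, ?_⟩
      · simp [hF0, hPx, (h i).zero, hPp]
      · refine R.trans (hFR (r a)) (R.trans ((inv_mem hP).2.2 (F (r a))) ?_)
        exact R.trans (hR i (l a) _) (hP.2.2 _)
      · have h1 : HasStrictFDerivAt (fun a => F (r a)) (F'.comp r) 0 :=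
          HasStrictFDerivAt.comp (0 : Fin (k + 1) → ℝ) (g := F) (f := r)
            (by rw [map_zero]; exact hF') r.hasStrictFDerivAt
        have h2 : HasStrictFDerivAt (fun a => Q (F (r a))) ((fderiv ℝ Q x).comp (F'.comp r)) 0 :=
          HasStrictFDerivAt.comp (0 : Fin (k + 1) → ℝ) (g := Q) (f := fun a => F (r a))
            (by rw [map_zero, hF0]; exact hQstrict) h1
        have h3 := l.hasStrictFDerivAt (x := 0).prodMk h2
        have h4 := HasStrictFDerivAt.comp (0 : Fin (k + 1) → ℝ)
          (g := fun q : ℝ × E => φ i q.1 q.2) (f := fun a => (l a, Q (F (r a))))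
          (by
            rw [map_zero, map_zero, hF0, hPx]
            exact (h i).hasStrictFDerivAt (hY i) p) h3
        refine HasStrictFDerivAt.comp (0 : Fin (k + 1) → ℝ) (g := P)
          (f := fun a => φ i (l a) (Q (F (r a)))) ?_ h4
        rw [map_zero, map_zero, hF0, hPx, (h i).zero]
        exact hPstrict
      · rw [Finset.coe_insert, Submodule.span_insert, sup_le_iff,
          Submodule.span_singleton_le_iff_mem]
        constructor
        · refine ⟨Fin.cons 1 0, ?_⟩
          have hr : r (Fin.cons 1 0) = 0 := by ext j; simp [r]
          have hl : l (Fin.cons 1 0) = 1 := by simp [l]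
          simp [hr, hl]
        · refine hFt.trans ?_
          rintro _ ⟨a, rfl⟩
          refine ⟨Fin.cons 0 a, ?_⟩
          have hr : r (Fin.cons 0 a) = a := by ext j; simp [r]
          have hl : l (Fin.cons 0 a) = 0 := by simp [l]
          have := DFunLike.congr_fun hPQ (F' a)
          simpa [hr, hl] using this
  obtain ⟨k, F, F', hF0, hFR, hF', hFs⟩ := key s hs
  have hmap := hF'.map_nhds_eq_of_surj (by rw [hs'] at hFs; exact top_le_iff.1 hFs)
  rw [hF0] at hmap
  rw [← hmap]
  exact mem_map.2 (univ_mem' hFR)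

end Orbit

/-! ### Lie brackets of vector fields read in a chart. -/

section ChartFields

open Filter VectorField

variable {n m : ℕ} {S : Type*} [TopologicalSpace S] [ChartedSpace (EuclideanSpace ℝ (Fin n)) S]
  [IsManifold (𝓡 n) ∞ S]

namespace SmoothVectorField

theorem mdifferentiableAt (A : SmoothVectorField n S) (x : S) :
    MDifferentiableAt (𝓡 n) (𝓡 n).tangent
      (fun y => (⟨y, A y⟩ : TangentBundle (𝓡 n) S)) x :=
  (A.contMDiff x).mdifferentiableAt (by simp)

theorem lieBracket_add_left (A B C : SmoothVectorField n S) :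
    lieBracket (A + B) C = lieBracket A C + lieBracket B C := by
  ext1 x
  exact mlieBracket_add_left (A.mdifferentiableAt x) (B.mdifferentiableAt x)

theorem lieBracket_smul_left (a : ℝ) (A B : SmoothVectorField n S) :
    lieBracket (a • A) B = a • lieBracket A B := by
  ext1 x
  exact mlieBracket_const_smul_left (A.mdifferentiableAt x)

theorem lieBracket_jacobi (A B C : SmoothVectorField n S) :
    lieBracket (lieBracket A B) C
      = lieBracket A (lieBracket B C) - lieBracket B (lieBracket A C) := by
  have h2 : minSmoothness ℝ 2 ≤ ∞ := by
    rw [minSmoothness_of_isRCLikeNormedField]; exact WithTop.coe_le_coe.2 (le_top : (2 : ℕ∞) ≤ ⊤)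
  have : IsManifold (𝓡 n) (minSmoothness ℝ 3) S := by
    rw [minSmoothness_of_isRCLikeNormedField]; infer_instance
  ext1 x
  have := leibniz_identity_mlieBracket_apply (I := 𝓡 n) (U := fun x => A x) (V := fun x => B x)
    (W := fun x => C x) (x := x) ((A.contMDiff x).of_le h2) ((B.contMDiff x).of_le h2)
    ((C.contMDiff x).of_le h2)
  exact eq_sub_of_add_eq this.symm

/-- The representation of a vector field in the chart at `x₀`. -/
noncomputable def inChart (x₀ : S) (A : SmoothVectorField n S) :
    EuclideanSpace ℝ (Fin n) → EuclideanSpace ℝ (Fin n) :=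
  mpullback 𝓘(ℝ, EuclideanSpace ℝ (Fin n)) (𝓡 n) (extChartAt (𝓡 n) x₀).symm (fun x => A x)

variable {x₀ : S} {z : EuclideanSpace ℝ (Fin n)}

theorem isInvertible_mfderiv_symm (hz : z ∈ (extChartAt (𝓡 n) x₀).target) :
    (mfderiv 𝓘(ℝ, EuclideanSpace ℝ (Fin n)) (𝓡 n) (extChartAt (𝓡 n) x₀).symm z).IsInvertible := by
  have : IsManifold (𝓡 n) 1 S := IsManifold.of_le (n := ∞) (by simp)
  have := isInvertible_mfderivWithin_extChartAt_symm hz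
  rwa [modelWithCornersSelf_coe, range_id, mfderivWithin_univ] at this

theorem contMDiffAt_symm (hz : z ∈ (extChartAt (𝓡 n) x₀).target) :
    ContMDiffAt 𝓘(ℝ, EuclideanSpace ℝ (Fin n)) (𝓡 n) ∞ (extChartAt (𝓡 n) x₀).symm z :=
  (contMDiffOn_extChartAt_symm x₀).contMDiffAt ((isOpen_extChartAt_target x₀).mem_nhds hz)

theorem contDiffAt_inChart (A : SmoothVectorField n S)
    (hz : z ∈ (extChartAt (𝓡 n) x₀).target) : ContDiffAt ℝ ∞ (A.inChart x₀) z := by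
  have : IsManifold (𝓡 n) (∞ + 1) S := by rw [show (∞ : ℕ∞ω) + 1 = ∞ by simp]; infer_instance
  exact contMDiffAt_vectorSpace_iff_contDiffAt.1 (ContMDiffAt.mpullback_vectorField_preimage
    (A.contMDiff _) (contMDiffAt_symm hz) (isInvertible_mfderiv_symm hz) (by simp))

theorem mfderiv_symm_inChart (A : SmoothVectorField n S)
    (hz : z ∈ (extChartAt (𝓡 n) x₀).target) :
    mfderiv 𝓘(ℝ, EuclideanSpace ℝ (Fin n)) (𝓡 n) (extChartAt (𝓡 n) x₀).symm z (A.inChart x₀ z)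
      = A ((extChartAt (𝓡 n) x₀).symm z) :=
  (isInvertible_mfderiv_symm hz).self_apply_inverse _

theorem inChart_lieBracket (A B : SmoothVectorField n S)
    (hz : z ∈ (extChartAt (𝓡 n) x₀).target) :
    (lieBracket A B).inChart x₀ z = VectorField.lieBracket ℝ (A.inChart x₀) (B.inChart x₀) z := by
  have h2 : minSmoothness ℝ 2 ≤ ∞ := by
    rw [minSmoothness_of_isRCLikeNormedField]; exact WithTop.coe_le_coe.2 (le_top : (2 : ℕ∞) ≤ ⊤)
  have : IsManifold (𝓡 n) (minSmoothness ℝ 3) S := by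
    rw [minSmoothness_of_isRCLikeNormedField]; infer_instance
  have := mpullback_mlieBracket (I := 𝓘(ℝ, EuclideanSpace ℝ (Fin n))) (I' := 𝓡 n)
    (f := (extChartAt (𝓡 n) x₀).symm) (A.mdifferentiableAt _)
    (B.mdifferentiableAt _) (contMDiffAt_symm hz) h2
  refine this.trans ?_
  rw [← mlieBracketWithin_univ, mlieBracketWithin_eq_lieBracketWithin]
  exact congrFun (lieBracketWithin_univ (V := A.inChart x₀) (W := B.inChart x₀)) z

theorem inChart_add (A B : SmoothVectorField n S) :
    (A + B).inChart x₀ z = A.inChart x₀ z + B.inChart x₀ z := by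
  exact mpullback_add_apply

theorem inChart_smul (a : ℝ) (A : SmoothVectorField n S) :
    (a • A).inChart x₀ z = a • A.inChart x₀ z := by
  exact mpullback_const_smul_apply

/-- If a family of subspaces contains the fields `X i` and is preserved by taking brackets with
them, then it contains the whole generated Lie triple system. -/
theorem inChart_mem_of_mem_lieTripleSpan {X : Fin m → SmoothVectorField n S}
    {W : Set (EuclideanSpace ℝ (Fin n))}
    {D : EuclideanSpace ℝ (Fin n) → Submodule ℝ (EuclideanSpace ℝ (Fin n))}
    (hX : ∀ i, ∀ z ∈ W, (X i).inChart x₀ z ∈ D z)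
    (hbr : ∀ i (Z : SmoothVectorField n S), (∀ z ∈ W, Z.inChart x₀ z ∈ D z) →
      ∀ z ∈ W, (lieBracket (X i) Z).inChart x₀ z ∈ D z)
    {A : SmoothVectorField n S} (hA : A ∈ lieTripleSpan (Set.range X)) :
    ∀ z ∈ W, A.inChart x₀ z ∈ D z := by
  let good (A : SmoothVectorField n S) : Prop := ∀ z ∈ W, A.inChart x₀ z ∈ D z
  have hadd : ∀ {A B : SmoothVectorField n S}, good A → good B → good (A + B) := by
    intro A B hA hB z hz
    rw [inChart_add]
    exact add_mem (hA z hz) (hB z hz)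
  have hsmul : ∀ (a : ℝ) {A : SmoothVectorField n S}, good A → good (a • A) := by
    intro a A hA z hz
    rw [inChart_smul]
    exact Submodule.smul_mem _ _ (hA z hz)
  have hzero : good 0 := by
    intro z hz
    have : (0 : SmoothVectorField n S) = (0 : ℝ) • 0 := by simp
    rw [this, inChart_smul, zero_smul]
    exact zero_mem _
  -- Merely taking values in `D` is not visibly closed under brackets. Requiring also that the
  -- bracket with `A` preserve such fields gives a Lie subalgebra, by Jacobi; closure under double
  -- brackets follows.
  let V : Submodule ℝ (SmoothVectorField n S) :=
    { carrier := {A | good A ∧ ∀ Z, good Z → good (lieBracket A Z)}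
      add_mem' := by
        rintro A B ⟨hA, hA'⟩ ⟨hB, hB'⟩
        exact ⟨hadd hA hB, fun Z hZ => by
          rw [lieBracket_add_left]; exact hadd (hA' Z hZ) (hB' Z hZ)⟩
      zero_mem' := by
        refine ⟨hzero, fun Z _ => ?_⟩
        have : lieBracket 0 Z = (0 : ℝ) • lieBracket 0 Z := by
          rw [← lieBracket_smul_left, zero_smul]
        rw [this, zero_smul]
        exact hzero
      smul_mem' := by
        rintro a A ⟨hA, hA'⟩
        exact ⟨hsmul a hA, fun Z hZ => by
          rw [lieBracket_smul_left]; exact hsmul a (hA' Z hZ)⟩ }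
  have hbracket : ∀ A ∈ V, ∀ B ∈ V, lieBracket A B ∈ V := by
    rintro A ⟨hA, hA'⟩ B ⟨hB, hB'⟩
    refine ⟨hA' B hB, fun Z hZ => ?_⟩
    rw [lieBracket_jacobi, sub_eq_add_neg, ← neg_one_smul ℝ]
    exact hadd (hA' _ (hB' Z hZ)) (hsmul _ (hB' _ (hA' Z hZ)))
  have hle : lieTripleSpan (Set.range X) ≤ V := by
    refine sInf_le ⟨?_, fun A hA B hB C hC => hbracket _ (hbracket A hA B hB) C hC⟩
    rintro _ ⟨i, rfl⟩
    exact ⟨hX i, hbr i⟩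
  exact (hle hA).1

end SmoothVectorField

end ChartFields

/-! ### The equivalence relation of being joined by a trajectory. -/

section Steering

open Filter

variable {n m : ℕ} {S : Type*} [TopologicalSpace S] [ChartedSpace (EuclideanSpace ℝ (Fin n)) S]

/-- A linear map out of `ℝ` is determined by its value at `1`, so comparing derivatives of curves
reduces to comparing velocity vectors. -/
theorem hasMFDerivAt_of_apply_one {γ : ℝ → S} {t : ℝ}
    {L : TangentSpace 𝓘(ℝ, ℝ) t →L[ℝ] TangentSpace (𝓡 n) (γ t)}
    {L' : TangentSpace 𝓘(ℝ, ℝ) t →L[ℝ] TangentSpace (𝓡 n) (γ t)}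
    (h : HasMFDerivAt 𝓘(ℝ, ℝ) (𝓡 n) γ t L) (e : L (1 : ℝ) = L' (1 : ℝ)) :
    HasMFDerivAt 𝓘(ℝ, ℝ) (𝓡 n) γ t L' := by
  have : L = L' := ContinuousLinearMap.ext_ring (R₁ := ℝ) e
  exact this ▸ h

variable [IsManifold (𝓡 n) ∞ S]

/-- At time `t`, the curve `γ` is `C¹` and solves the driftless system with control `u`. -/
structure IsSteeringAt (X : Fin m → SmoothVectorField n S) (u : ℝ → EuclideanSpace ℝ (Fin m))
    (γ : ℝ → S) (t : ℝ) : Prop where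
  contMDiffAt : ContMDiffAt 𝓘(ℝ, ℝ) (𝓡 n) 1 γ t
  hasMFDerivAt : HasMFDerivAt 𝓘(ℝ, ℝ) (𝓡 n) γ t
    ((1 : ℝ →L[ℝ] ℝ).smulRight (driftless X (γ t) (u t)))

/-- `y` is joined to `x` by a `C¹` trajectory of the driftless system that rests outside the time
interval `[0, 1]`. -/
def IsSteered (X : Fin m → SmoothVectorField n S) (x y : S) : Prop :=
  ∃ (u : ℝ → EuclideanSpace ℝ (Fin m)) (γ : ℝ → S), Continuous u ∧
    (∀ t, IsSteeringAt X u γ t) ∧ (∀ t ≤ 0, u t = 0 ∧ γ t = x) ∧ (∀ t, 1 ≤ t → u t = 0 ∧ γ t = y)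

variable {X : Fin m → SmoothVectorField n S} {u v : ℝ → EuclideanSpace ℝ (Fin m)} {γ η : ℝ → S}

theorem driftless_smul (x : S) (a : ℝ) (w : EuclideanSpace ℝ (Fin m)) :
    driftless X x (a • w) = a • driftless X x w := by
  simp [driftless, Finset.smul_sum, mul_smul]

theorem IsSteeringAt.congr {t : ℝ} (h : IsSteeringAt X u γ t) (hγ : η =ᶠ[𝓝 t] γ)
    (hu : v t = u t) : IsSteeringAt X v η t := by
  refine ⟨h.contMDiffAt.congr_of_eventuallyEq hγ, ?_⟩
  have h1 := h.hasMFDerivAt.congr_of_eventuallyEq hγ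
  -- The two sides live in tangent spaces at different expressions for one point; both unfold to the
  -- model space, where they can be compared.
  have h2 : (driftless X (γ t) (u t) : EuclideanSpace ℝ (Fin n)) = driftless X (η t) (v t) := by
    rw [hu]
    exact congrArg (fun q : S => (driftless X q (u t) : EuclideanSpace ℝ (Fin n)))
      hγ.self_of_nhds.symm
  refine hasMFDerivAt_of_apply_one h1 ?_
  change (1 : ℝ) • (driftless X (γ t) (u t) : EuclideanSpace ℝ (Fin n))
    = (1 : ℝ) • (driftless X (η t) (v t) : EuclideanSpace ℝ (Fin n))
  exact congrArg (fun w => (1 : ℝ) • w) h2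

/-- Affine reparametrization of time. -/
theorem IsSteeringAt.comp_affine {c d t : ℝ} (h : IsSteeringAt X u γ (c * t + d)) :
    IsSteeringAt X (fun s => c • u (c * s + d)) (fun s => γ (c * s + d)) t := by
  have hd : HasDerivAt (fun s => c * s + d) c t := by
    simpa using ((hasDerivAt_id t).const_mul c).add_const d
  constructor
  · refine ContMDiffAt.comp t (g := γ) (f := fun s => c * s + d) h.contMDiffAt ?_
    exact contMDiffAt_iff_contDiffAt.2 (by fun_prop)
  · have h1 := HasMFDerivAt.comp t h.hasMFDerivAt hd.hasFDerivAt.hasMFDerivAt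
    refine hasMFDerivAt_of_apply_one h1 ?_
    rw [driftless_smul]
    change ((1 : ℝ) • c) • (driftless X (γ (c * t + d)) (u (c * t + d)) :
      EuclideanSpace ℝ (Fin n)) = (1 : ℝ) • c • (driftless X (γ (c * t + d)) (u (c * t + d)) :
      EuclideanSpace ℝ (Fin n))
    simp

theorem IsSteered.refl (x : S) : IsSteered X x x := by
  refine ⟨fun _ => 0, fun _ => x, continuous_const, fun t => ⟨contMDiffAt_const, ?_⟩, ?_, ?_⟩
  · have : driftless X x (0 : EuclideanSpace ℝ (Fin m)) = 0 := by simp [driftless]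
    refine hasMFDerivAt_of_apply_one (hasMFDerivAt_const x t) ?_
    rw [this]
    change (0 : EuclideanSpace ℝ (Fin n)) = (1 : ℝ) • (0 : EuclideanSpace ℝ (Fin n))
    simp
  · simp
  · simp

theorem IsSteered.symm {x y : S} (h : IsSteered X x y) : IsSteered X y x := by
  obtain ⟨u, γ, hu, hγ, h0, h1⟩ := h
  refine ⟨fun s => (-1 : ℝ) • u (-1 * s + 1), fun s => γ (-1 * s + 1), by fun_prop,
    fun t => (hγ _).comp_affine, fun t ht => ?_, fun t ht => ?_⟩
  · have := h1 (-1 * t + 1) (by linarith)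
    simp only [this.1, this.2, smul_zero, and_self]
  · have := h0 (-1 * t + 1) (by linarith)
    simp only [this.1, this.2, smul_zero, and_self]

theorem IsSteered.trans {x y z : S} (h : IsSteered X x y) (h' : IsSteered X y z) : IsSteered X x z := by
  obtain ⟨u, γ, hu, hγ, h0, h1⟩ := h
  obtain ⟨v, η, hv, hη, h0', h1'⟩ := h'
  -- At triple speed the first leg ends at time `1/3` and the second starts at `2/3`. In between
  -- both curves rest at `y`, so the switch at `1/2` is invisible and near every time the path
  -- coincides with one of the legs.
  have hl : ∀ t : ℝ, t < 2 / 3 →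
      (if t ≤ 1 / 2 then γ (3 * t + 0) else η (3 * t + -2)) = γ (3 * t + 0) ∧
      v (3 * t + -2) = 0 := by
    intro t ht
    refine ⟨?_, (h0' _ (by linarith)).1⟩
    split_ifs with h
    · rfl
    · rw [(h0' (3 * t + -2) (by linarith)).2, (h1 (3 * t + 0) (by linarith)).2]
  have hr : ∀ t : ℝ, 1 / 3 < t →
      (if t ≤ 1 / 2 then γ (3 * t + 0) else η (3 * t + -2)) = η (3 * t + -2) ∧
      u (3 * t + 0) = 0 := by
    intro t ht
    refine ⟨?_, (h1 _ (by linarith)).1⟩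
    split_ifs with h
    · rw [(h0' (3 * t + -2) (by linarith)).2, (h1 (3 * t + 0) (by linarith)).2]
    · rfl
  refine ⟨fun t => (3 : ℝ) • u (3 * t + 0) + (3 : ℝ) • v (3 * t + -2),
    fun t => if t ≤ 1 / 2 then γ (3 * t + 0) else η (3 * t + -2), by fun_prop,
    fun t => ?_, fun t ht => ?_, fun t ht => ?_⟩
  · rcases lt_or_ge t (2 / 3) with ht | ht
    · refine (hγ (3 * t + 0)).comp_affine.congr ?_ ?_
      · filter_upwards [Iio_mem_nhds ht] with s hs using (hl s hs).1
      · simp [(hl t ht).2]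
    · have ht' : 1 / 3 < t := by linarith
      refine (hη (3 * t + -2)).comp_affine.congr ?_ ?_
      · filter_upwards [Ioi_mem_nhds ht'] with s hs using (hr s hs).1
      · simp only [(hr t ht').2, smul_zero, zero_add]
  · obtain ⟨h2, h3⟩ := hl t (by linarith)
    obtain ⟨h4, h5⟩ := h0 (3 * t + 0) (by linarith)
    refine ⟨?_, h2.trans h5⟩
    change (3 : ℝ) • u (3 * t + 0) + (3 : ℝ) • v (3 * t + -2) = 0
    rw [h3, h4, smul_zero, add_zero]
  · obtain ⟨h2, h3⟩ := hr t (by linarith)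
    obtain ⟨h4, h5⟩ := h1' (3 * t + -2) (by linarith)
    refine ⟨?_, h2.trans h5⟩
    change (3 : ℝ) • u (3 * t + 0) + (3 : ℝ) • v (3 * t + -2) = 0
    rw [h3, h4, smul_zero, add_zero]

/-- A solution in a chart of the equation of motion yields a trajectory. -/
theorem isSteeringAt_of_inChart {x₀ : S} {c : ℝ → EuclideanSpace ℝ (Fin n)}
    (hc : ContDiff ℝ 1 c) {t : ℝ} (ht : c t ∈ (extChartAt (𝓡 n) x₀).target)
    (hd : HasDerivAt c (∑ i, u t i • (X i).inChart x₀ (c t)) t) :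
    IsSteeringAt X u (fun s => (extChartAt (𝓡 n) x₀).symm (c s)) t := by
  have hsymm := SmoothVectorField.contMDiffAt_symm ht
  constructor
  · exact ContMDiffAt.comp t (hsymm.of_le (by simp)) (contMDiffAt_iff_contDiffAt.2 hc.contDiffAt)
  · have h1 := HasMFDerivAt.comp t (hsymm.mdifferentiableAt (by simp)).hasMFDerivAt
      hd.hasFDerivAt.hasMFDerivAt
    refine hasMFDerivAt_of_apply_one h1 ?_
    have h2 : mfderiv 𝓘(ℝ, EuclideanSpace ℝ (Fin n)) (𝓡 n) (extChartAt (𝓡 n) x₀).symm (c t)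
        (∑ i, u t i • (X i).inChart x₀ (c t)) =
        driftless X ((extChartAt (𝓡 n) x₀).symm (c t)) (u t) := by
      refine (map_sum _ _ _).trans ?_
      refine Finset.sum_congr rfl fun i _ => ?_
      rw [← SmoothVectorField.mfderiv_symm_inChart (X i) ht]
      exact map_smul _ _ _
    change mfderiv 𝓘(ℝ, EuclideanSpace ℝ (Fin n)) (𝓡 n) (extChartAt (𝓡 n) x₀).symm (c t)
        ((1 : ℝ) • ∑ i, u t i • (X i).inChart x₀ (c t)) =
      (1 : ℝ) • driftless X ((extChartAt (𝓡 n) x₀).symm (c t)) (u t)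
    rw [one_smul, one_smul]
    exact h2

end Steering

/-! ### Openness of reachable sets and global controllability. -/

section Chow

open Filter

variable {n m : ℕ} {S : Type*} [TopologicalSpace S] [ChartedSpace (EuclideanSpace ℝ (Fin n)) S]
  [IsManifold (𝓡 n) ∞ S] {X : Fin m → SmoothVectorField n S}

/-- Equality, or lying in the chart domain at `x₀` and being joined by a trajectory. -/
def chartSetoid (X : Fin m → SmoothVectorField n S) (x₀ : S) :
    Setoid (EuclideanSpace ℝ (Fin n)) where
  r z w := z = w ∨ (z ∈ (extChartAt (𝓡 n) x₀).target ∧ w ∈ (extChartAt (𝓡 n) x₀).target ∧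
    IsSteered X ((extChartAt (𝓡 n) x₀).symm z) ((extChartAt (𝓡 n) x₀).symm w))
  iseqv :=
    { refl := fun _ => Or.inl rfl
      symm := by
        rintro z w (rfl | ⟨hz, hw, h⟩)
        · exact Or.inl rfl
        · exact Or.inr ⟨hw, hz, h.symm⟩
      trans := by
        rintro z w y (rfl | ⟨hz, hw, h⟩) h'
        · exact h'
        · rcases h' with rfl | ⟨-, hy, h'⟩
          · exact Or.inr ⟨hz, hw, h⟩
          · exact Or.inr ⟨hz, hy, h.trans h'⟩ }

/-- At such times the function attains its global minimum `0` or its global maximum `1`. -/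
theorem deriv_smoothTransition_eq_zero {t : ℝ} (ht : t ≤ 0 ∨ 1 ≤ t) :
    deriv Real.smoothTransition t = 0 := by
  rcases ht with ht | ht
  · refine IsLocalMin.deriv_eq_zero (Eventually.of_forall fun s => ?_)
    rw [Real.smoothTransition.zero_of_nonpos ht]
    exact Real.smoothTransition.nonneg s
  · refine IsLocalMax.deriv_eq_zero (Eventually.of_forall fun s => ?_)
    rw [Real.smoothTransition.one_of_one_le ht]
    exact Real.smoothTransition.le_one s

/-- Points on a flow line, inside a chart, of a multiple of one of the fields are joined by a
trajectory. -/
theorem isSteered_of_flow {x₀ : S} {i : Fin m} {χ : EuclideanSpace ℝ (Fin n) → ℝ}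
    (hχ : Continuous χ) {c : ℝ → EuclideanSpace ℝ (Fin n)}
    (hc : ∀ t, c t ∈ (extChartAt (𝓡 n) x₀).target)
    (hd : ∀ t, HasDerivAt c (χ (c t) • (X i).inChart x₀ (c t)) t) (T : ℝ) :
    IsSteered X ((extChartAt (𝓡 n) x₀).symm (c 0)) ((extChartAt (𝓡 n) x₀).symm (c T)) := by
  have hcc : Continuous c := continuous_iff_continuousAt.2 fun t => (hd t).continuousAt
  have hθ : ContDiff ℝ 1 Real.smoothTransition := Real.smoothTransition.contDiff (n := 1)
  have hθ' : Continuous (deriv Real.smoothTransition) := hθ.continuous_deriv le_rfl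
  have hcd : ContDiff ℝ 1 c := by
    refine contDiff_one_iff_deriv.2 ⟨fun t => (hd t).differentiableAt, ?_⟩
    have : deriv c = fun t => χ (c t) • (X i).inChart x₀ (c t) := funext fun t => (hd t).deriv
    rw [this]
    refine (hχ.comp hcc).smul (continuous_iff_continuousAt.2 fun t => ?_)
    exact ((X i).contDiffAt_inChart (hc t)).continuousAt.comp hcc.continuousAt
  -- The scalar control produced by the chain rule for `c (T * θ t)`, where `θ` is the smooth
  -- transition: it absorbs the cutoff `χ` and vanishes outside `[0, 1]`. The sign of `T` is
  -- irrelevant.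
  let w : ℝ → ℝ := fun t => T * deriv Real.smoothTransition t * χ (c (T * Real.smoothTransition t))
  have hw : Continuous w :=
    (continuous_const.mul hθ').mul (hχ.comp (hcc.comp
      (continuous_const.mul Real.smoothTransition.continuous)))
  refine ⟨fun t => w t • EuclideanSpace.single i (1 : ℝ),
    fun t => (extChartAt (𝓡 n) x₀).symm (c (T * Real.smoothTransition t)),
    hw.smul continuous_const, fun t => ?_, fun t ht => ⟨?_, ?_⟩, fun t ht => ⟨?_, ?_⟩⟩
  · refine isSteeringAt_of_inChart (c := fun t => c (T * Real.smoothTransition t))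
      (hcd.comp (contDiff_const.mul hθ)) (hc _) ?_
    have h1 : HasDerivAt (fun t => T * Real.smoothTransition t)
        (T * deriv Real.smoothTransition t) t :=
      ((hθ.differentiable one_ne_zero t).hasDerivAt).const_mul T
    have h2 := (hd (T * Real.smoothTransition t)).scomp t h1
    convert! h2 using 1
    simp [w, smul_smul]
  · simp [w, deriv_smoothTransition_eq_zero (Or.inl ht)]
  · simp [Real.smoothTransition.zero_of_nonpos ht]
  · simp [w, deriv_smoothTransition_eq_zero (Or.inr ht)]
  · simp [Real.smoothTransition.one_of_one_le ht]

/-- If the fields generate the tangent space at all points, then every point can be steered to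
all points of a neighbourhood. -/
theorem setOf_isSteered_mem_nhds
    (hX : ∀ (x : S) (v : TangentSpace (𝓡 n) x),
      ∃ Y ∈ SmoothVectorField.lieTripleSpan (Set.range X), Y x = v) (x₀ : S) :
    {y | IsSteered X x₀ y} ∈ 𝓝 x₀ := by
  set e := extChartAt (𝓡 n) x₀ with he
  have hopen : IsOpen e.target := isOpen_extChartAt_target x₀
  have hmem : e x₀ ∈ e.target := mem_extChartAt_target x₀
  obtain ⟨r, hr, hball⟩ := Metric.nhds_basis_closedBall.mem_iff.1 (hopen.mem_nhds hmem)
  let χ : ContDiffBump (e x₀) := ⟨r / 2, r, by linarith, by linarith⟩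
  have hsupp : tsupport χ ⊆ e.target := by rw [χ.tsupport_eq]; exact hball
  let Y : Fin m → EuclideanSpace ℝ (Fin n) → EuclideanSpace ℝ (Fin n) :=
    fun i z => χ z • (X i).inChart x₀ z
  have hY0 : ∀ i z, Y i z ≠ 0 → z ∈ e.target := fun i z hz =>
    hsupp (subset_tsupport _ (fun h0 => hz (by simp only [Y, h0, zero_smul])))
  have hYs : ∀ i, ContDiff ℝ ∞ (Y i) := by
    intro i
    refine contDiff_iff_contDiffAt.2 fun z => ?_
    by_cases hz : z ∈ e.target
    · exact χ.contDiffAt.smul ((X i).contDiffAt_inChart hz)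
    · have : Y i =ᶠ[𝓝 z] fun _ => 0 := by
        filter_upwards [(isClosed_tsupport χ).isOpen_compl.mem_nhds (fun h => hz (hsupp h))]
          with w hw
        simp only [Y, image_eq_zero_of_notMem_tsupport hw, zero_smul]
      exact contDiffAt_const.congr_of_eventuallyEq this
  have hYc : ∀ i, HasCompactSupport (Y i) := fun i => χ.hasCompactSupport.smul_right
  choose φ M ε hφ using fun i => exists_isC1Flow (hYs i) (hYc i)
  -- A flow line that leaves its starting point stays where `Y i` is nonzero, hence inside the
  -- support of the bump.
  have hstay : ∀ i t z, z ∈ e.target → φ i t z ∈ e.target := by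
    intro i t z hz
    rcases (hφ i).eq_or_ne_zero t z with h | h
    · rwa [h]
    · exact hY0 i _ h
  have hR : ∀ i t z, chartSetoid X x₀ z (φ i t z) := by
    intro i t z
    by_cases hz : z ∈ e.target
    · refine Or.inr ⟨hz, hstay i t z hz, ?_⟩
      have := isSteered_of_flow (X := X) (x₀ := x₀) (i := i) χ.continuous
        (c := fun s => φ i s z) (fun s => hstay i s z hz) ((hφ i).hasDerivAt z) t
      simpa only [(hφ i).zero] using this
    -- Points outside the chart target are zeros of `Y i`, so they are fixed; the dichotomy is
    -- applied to the flow run backwards from `φ i t z`.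
    · left
      have h1 := (hφ i).eq_or_ne_zero (-t) (φ i t z)
      rw [← (hφ i).add, neg_add_cancel, (hφ i).zero] at h1
      exact h1.resolve_right fun h => hz (hY0 i z h)
  have hW : ∀ z ∈ Metric.ball (e x₀) (r / 2), z ∈ e.target ∧ χ z = 1 := fun z hz =>
    ⟨hball (Metric.ball_subset_closedBall (Metric.ball_subset_ball (by linarith) hz)),
      χ.one_of_mem_closedBall (Metric.ball_subset_closedBall hz)⟩
  have hD : orbitDistribution (chartSetoid X x₀) Y (e x₀) = ⊤ := by
    refine (Submodule.eq_top_iff'.2 fun v => ?_)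
    obtain ⟨A, hA, hAv⟩ := hX (e.symm (e x₀))
      (mfderiv 𝓘(ℝ, EuclideanSpace ℝ (Fin n)) (𝓡 n) e.symm (e x₀) v)
    have hv : A.inChart x₀ (e x₀) = v := by
      have h1 := SmoothVectorField.mfderiv_symm_inChart A hmem
      exact (SmoothVectorField.isInvertible_mfderiv_symm hmem).injective (h1.trans hAv)
    rw [← hv]
    -- Membership in `D` is propagated over an open ball, not only at the centre, because a bracket
    -- depends on nearby values; on this ball `χ = 1`, so `Y i` and `X i` have the same germs.
    refine SmoothVectorField.inChart_mem_of_mem_lieTripleSpan (X := X) (x₀ := x₀)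
      (W := Metric.ball (e x₀) (r / 2)) (D := orbitDistribution (chartSetoid X x₀) Y)
      (fun i z hz => ?_) (fun i Z hZ z hz => ?_) hA (e x₀) (Metric.mem_ball_self (by linarith))
    · have := mem_orbitDistribution (R := chartSetoid X x₀) (Y := Y) i z
      simpa only [Y, (hW z hz).2, one_smul] using this
    · have hnhds := Metric.isOpen_ball.mem_nhds hz
      have hYX : (X i).inChart x₀ =ᶠ[𝓝 z] Y i := by
        filter_upwards [hnhds] with w hw
        simp only [Y, (hW w hw).2, one_smul]
      rw [SmoothVectorField.inChart_lieBracket _ _ (hW z hz).1,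
        hYX.lieBracket_vectorField_eq EventuallyEq.rfl]
      refine lieBracket_mem_orbitDistribution hφ hR i
        ((Z.contDiffAt_inChart (hW z hz).1).differentiableAt (by simp)) ?_
      filter_upwards [hnhds] with w hw using hZ w hw
  have hnhds := setOf_rel_mem_nhds hφ (fun i => (hYs i).continuous) hR hD
  filter_upwards [(continuousAt_extChartAt x₀).preimage_mem_nhds hnhds,
    extChartAt_source_mem_nhds (I := 𝓡 n) x₀] with y hy hys
  have hx : e.symm (e x₀) = x₀ := e.left_inv (mem_extChartAt_source x₀)
  rcases hy with h | ⟨-, -, h⟩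
  · have : x₀ = y := e.injOn (mem_extChartAt_source x₀) hys h
    exact this ▸ IsSteered.refl x₀
  · change IsSteered X (e.symm (e x₀)) (e.symm (e y)) at h
    rwa [hx, e.left_inv hys] at h

/-- Classes of an equivalence relation with neighbourhood classes are open, and so are their
complements, as unions of other classes. -/
theorem isSteered_of_connected [ConnectedSpace S]
    (hX : ∀ (x : S) (v : TangentSpace (𝓡 n) x),
      ∃ Y ∈ SmoothVectorField.lieTripleSpan (Set.range X), Y x = v) (x y : S) :
    IsSteered X x y := by
  have hclopen : IsClopen {y | IsSteered X x y} := by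
    constructor
    · rw [← isOpen_compl_iff, isOpen_iff_mem_nhds]
      intro y hy
      filter_upwards [setOf_isSteered_mem_nhds hX y] with z hz hxz
      exact hy (IsSteered.trans hxz hz.symm)
    · rw [isOpen_iff_mem_nhds]
      intro y hy
      filter_upwards [setOf_isSteered_mem_nhds hX y] with z hz
      exact IsSteered.trans hy hz
  exact eq_univ_iff_forall.1 (hclopen.eq_univ ⟨x, IsSteered.refl x⟩) y

theorem isAbsContCurveOn_of_contMDiff {γ : ℝ → S}
    (hγ : ContMDiff 𝓘(ℝ, ℝ) (𝓡 n) 1 γ) (T : ℝ) : IsAbsContCurveOn n γ T := by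
  refine ⟨hγ.continuous.continuousOn, fun x a b _ hab _ hmaps => ?_⟩
  refine ContDiffOn.absolutelyContinuousOnInterval fun t ht => ?_
  rw [uIcc_of_le hab] at ht
  have : IsManifold (𝓡 n) 1 S := IsManifold.of_le (n := ∞) (by simp)
  have h1 : ContMDiffAt (𝓡 n) (𝓡 n) 1 (chartAt (EuclideanSpace ℝ (Fin n)) x) (γ t) :=
    contMDiffAt_of_mem_maximalAtlas (IsManifold.chart_mem_maximalAtlas x) (hmaps ht)
  exact (contMDiffAt_iff_contDiffAt.1 (h1.comp t (hγ t))).contDiffWithinAt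

end Chow

theorem mainTheorem1 (n m : ℕ) (S : Type*) [TopologicalSpace S] [T2Space S] [ConnectedSpace S]
    [ChartedSpace (EuclideanSpace ℝ (Fin n)) S] [IsManifold (𝓡 n) ∞ S]
    (hS : IsSymmetricSpace n S) (X : Fin m → SmoothVectorField n S)
    (hX : ∀ (x : S) (v : TangentSpace (𝓡 n) x),
      ∃ Y ∈ SmoothVectorField.lieTripleSpan (Set.range X), Y x = v) :
    IsGloballyControllable (driftless X) := by
  intro x y T hT
  obtain ⟨u, γ, hu, hγ, h0, h1⟩ := isSteered_of_connected hX x y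
  -- The unit time interval is stretched to `[0, T]`, and the control is divided by `T` to
  -- compensate. It stays continuous, hence bounded on `[0, T]` and in `L²`.
  have hst : ∀ t, IsSteeringAt X (fun s => T⁻¹ • u (T⁻¹ * s + 0)) (fun s => γ (T⁻¹ * s + 0)) t :=
    fun t => (hγ _).comp_affine
  have hcont : Continuous fun s => T⁻¹ • u (T⁻¹ * s + 0) := by fun_prop
  refine ⟨_, ?_, _, ⟨isAbsContCurveOn_of_contMDiff (fun t => (hst t).contMDiffAt) T, ?_,
    Filter.Eventually.of_forall fun t => (hst t).hasMFDerivAt⟩, ?_⟩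
  · obtain ⟨C, hC⟩ := isCompact_Icc.exists_bound_of_continuousOn (s := Icc 0 T) hcont.continuousOn
    refine MemLp.of_bound hcont.aestronglyMeasurable C ?_
    exact (ae_restrict_iff' measurableSet_Icc).2 (Filter.Eventually.of_forall hC)
  · exact (h0 _ (by simp)).2
  · exact (h1 _ (by simp [hT.ne'])).2
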